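/- All rings are associative with identity. The (Gabriel–Rentschler) Krull dimension of a module is defined as follows: $\mathcal K_{-1}$ is the class of zero modules and, for an ordinal $\alpha\ge 0$, $\mathcal K_\alpha$ is the class of modules $M$ such that for every descending chain $M_0\supseteq M_1\supseteq\cdots$ of submodules of $M$ one has $M_i/M_{i+1}\in\bigcup_{\beta<\alpha}\mathcal K_\beta$ for all but finitely many $i$ (here $-1$ counts as an ordinal). If $M$ lies in some $\mathcal K_\alpha$, then $M$ is said to have Krull dimension, and $\operatorname{Kdim}(M)$ is the least such $\alpha$. The right Krull dimension $\operatorname{rKdim}(R)$ of a ring $R$ is $\operatorname{Kdim}(R_R)$, and the left Krull dimension $\operatorname{lKdim}(R)$ is $\operatorname{Kdim}({}_RR)$; an inequality such as $\operatorname{rKdim}(R)\le 1$ includes the assertion that the dimension exists. A ring $R$ satisfies left ACC-reg if it satisfies the ascending chain condition on left ideals of the form $Rs$ with $s\in R$ a regular element (neither a left nor a right zero-divisor). A principal right ideal ring is a ring all of whose right ideals are principal; a principal ideal ring is a ring all of whose left ideals and all of whose right ideals are principal. Let $R$ be a semiprime ring (that is, $aRa=0$ implies $a=0$ for $a \in R$).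 (a) Suppose that $R$ has right Krull dimension and satisfies left ACC-reg. If all maximal right ideals of $R$ are principal, then $\operatorname{rKdim}(R)\le 1$ and $R$ is a principal right ideal ring. (b) $R$ is a principal ideal ring if and only if $\operatorname{lKdim}(R)\le 1$, $\operatorname{rKdim}(R)\le 1$, and all maximal left ideals and all maximal right ideals of $R$ are principal. (c) Suppose that $R$ satisfies left ACC-reg. Then $R$ is a principal right ideal ring if and only if $\operatorname{rKdim}(R)\le 1$ and all maximal right ideals of $R$ are principal. -/

import Mathlib

universe u v

/-- The class `𝒦_α` of `R`-modules in the inductive definition of the Gabriel-Rentschler Krull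
dimension.  The index `α` is an ordinal or `-1`, the latter being written `⊥`.  `𝒦_{-1}` consists
of the zero modules; for `α ≥ 0`, `M` lies in `𝒦_α` if every descending chain
`M₀ ⊇ M₁ ⊇ ⋯` of submodules of `M` has `Mᵢ / Mᵢ₊₁ ∈ ⋃_{β < α} 𝒦_β` for almost all `i`. -/
def KrullClass (R : Type u) [Ring R] (α : WithBot Ordinal.{v}) (M : Type v)
    [AddCommGroup M] [Module R M] : Prop :=
  (α = ⊥ ∧ Subsingleton M) ∨
  (α ≠ ⊥ ∧ ∀ f : ℕ → Submodule R M, Antitone f →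
    ∀ᶠ i in Filter.atTop, ∃ β : WithBot Ordinal.{v}, ∃ _hβ : β < α,
      KrullClass R β (↥(f i) ⧸ (f (i + 1)).submoduleOf (f i)))
termination_by wellFounded_lt.wrap α

/-- An `R`-module has Krull dimension if it lies in some class `𝒦_α`. -/
def HasKrullDim (R : Type u) [Ring R] (M : Type v) [AddCommGroup M] [Module R M] : Prop :=
  ∃ α : WithBot Ordinal.{v}, KrullClass R α M

open Classical in
/-- The Gabriel-Rentschler Krull dimension of a module: the least `α` (an ordinal or `-1 = ⊥`) with
`M ∈ 𝒦_α`, and the value `⊤` if the Krull dimension of `M` does not exist. -/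
noncomputable def krullDimModule (R : Type u) [Ring R] (M : Type v) [AddCommGroup M]
    [Module R M] : WithTop (WithBot Ordinal.{v}) :=
  if h : HasKrullDim R M then
    ((wellFounded_lt.min {α : WithBot Ordinal.{v} | KrullClass R α M} h : WithBot Ordinal.{v}) :
      WithTop (WithBot Ordinal.{v}))
  else ⊤

/-- The right Krull dimension of a ring: the Krull dimension of the right module `R_R`. -/
noncomputable def rKdim (R : Type u) [Ring R] : WithTop (WithBot Ordinal.{u}) :=
  krullDimModule Rᵐᵒᵖ R

/-- The left Krull dimension of a ring: the Krull dimension of the left module `_R R`. -/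
noncomputable def lKdim (R : Type u) [Ring R] : WithTop (WithBot Ordinal.{u}) :=
  krullDimModule R R

/-- A ring is semiprime if `aRa = 0` implies `a = 0`. -/
def IsSemiprimeRing (R : Type u) [Ring R] : Prop :=
  ∀ a : R, (∀ r : R, a * r * a = 0) → a = 0

/-- Left ACC-reg: the ascending chain condition on left ideals `Rs` with `s` a regular element. -/
def LeftACCReg (R : Type u) [Ring R] : Prop :=
  ∀ f : ℕ → Ideal R, Monotone f → (∀ n, ∃ s : R, IsRegular s ∧ f n = Ideal.span {s}) →
    ∃ n, ∀ m, n ≤ m → f m = f n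

/-- Every maximal right ideal is principal.  Right ideals are the `Rᵐᵒᵖ`-submodules of `R`. -/
def MaximalRightIdealsPrincipal (R : Type u) [Ring R] : Prop :=
  ∀ I : Submodule Rᵐᵒᵖ R, IsCoatom I → I.IsPrincipal

/-- Every maximal left ideal is principal. -/
def MaximalLeftIdealsPrincipal (R : Type u) [Ring R] : Prop :=
  ∀ I : Ideal R, I.IsMaximal → I.IsPrincipal

/-- A principal right ideal ring: every right ideal is principal. -/
def IsPRIR (R : Type u) [Ring R] : Prop :=
  ∀ I : Submodule Rᵐᵒᵖ R, I.IsPrincipal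

/-- A principal left ideal ring: every left ideal is principal. -/
def IsPLIR (R : Type u) [Ring R] : Prop :=
  ∀ I : Ideal R, I.IsPrincipal

/-- A principal ideal ring: every left ideal and every right ideal is principal. -/
def IsPIR (R : Type u) [Ring R] : Prop :=
  IsPRIR R ∧ IsPLIR R

/-! The core is Goldie theory for left ideals of a semiprime ring `S`, applied to both `R` and
`Rᵐᵒᵖ`. Krull dimension excludes infinite direct sums of left ideals and, with semiprimeness, forces
nonsingularity. Hence every essential left ideal contains a regular element, and both factors of a
regular product are regular (`IsRegular.of_mul`).

Principality: a nonprincipal essential left ideal `E` lies in a maximal `Sa`, so `E = E'a` with `E'`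
again nonprincipal, and a regular `c ∈ E` factors as `c = c'a` with `c' ∈ E'`. Since `a` is not a
unit, repetition gives a strictly ascending chain `cS ⊂ c'S ⊂ ⋯`, excluded by the chain condition on
the other side (`RegularACC`). An arbitrary `I` is a summand of an essential `I ⊕ C = S(i + c)`,
whence `I = Si`.

Dimension: when left ideals are principal, the same chain condition makes `S/F` artinian for `F`
essential, and in a descending chain all but finitely many terms are essential in their
predecessors. Conversely, dimension at most one makes `S/Sd` artinian for `d` regular, which yields
`RegularACC` (`KrullClass.regularACC`); so (b) needs no chain condition. -/

section KrullClass

/-! ### Krull classes: closure properties and small values -/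

variable {R : Type u} [Ring R] {M N : Type v} [AddCommGroup M] [Module R M] [AddCommGroup N]
  [Module R N]

theorem krullClass_bot_iff : KrullClass R ⊥ M ↔ Subsingleton M := by
  rw [KrullClass]; simp

theorem krullClass_iff {α : WithBot Ordinal.{v}} (hα : α ≠ ⊥) :
    KrullClass R α M ↔ ∀ f : ℕ → Submodule R M, Antitone f →
      ∀ᶠ i in Filter.atTop, ∃ β < α, KrullClass R β (↥(f i) ⧸ (f (i + 1)).submoduleOf (f i)) := by
  rw [KrullClass]; simp [hα]

theorem Submodule.mapQ_injective_of_comap_eq (p : Submodule R M) (q : Submodule R N)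
    (l : M →ₗ[R] N) (h : q.comap l = p) : Function.Injective (p.mapQ q l h.ge) := by
  rw [← LinearMap.ker_eq_bot, Submodule.ker_mapQ, h, Submodule.mkQ_map_self]

/-- A linear map which sends `A` to `A'`, and only the elements of `B` to `B'`, embeds
`A / B` in `A' / B'`. -/
theorem exists_injective_subquotient (φ : M →ₗ[R] N) {A B : Submodule R M} {A' B' : Submodule R N}
    (hA : ∀ x ∈ A, φ x ∈ A') (hB : ∀ x ∈ A, φ x ∈ B' ↔ x ∈ B) :
    ∃ ψ : (A ⧸ B.submoduleOf A) →ₗ[R] (A' ⧸ B'.submoduleOf A'), Function.Injective ψ :=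
  ⟨_, Submodule.mapQ_injective_of_comap_eq _ _ (φ.restrict hA) (by
    ext x
    simpa [Submodule.submoduleOf] using hB x x.2)⟩

theorem KrullClass.of_injective {α : WithBot Ordinal.{v}} (h : KrullClass R α M)
    (φ : N →ₗ[R] M) (hφ : Function.Injective φ) : KrullClass R α N := by
  induction α using WellFoundedLT.induction generalizing M N with
  | ind α ih =>
    by_cases hα : α = ⊥
    · subst hα
      rw [krullClass_bot_iff] at h ⊢
      exact hφ.subsingleton
    · rw [krullClass_iff hα] at h ⊢
      intro f hf
      filter_upwards [h (fun i => (f i).map φ) fun i j hij => Submodule.map_mono (hf hij)]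
        with i ⟨β, hβ, hK⟩
      obtain ⟨ψ, hψ⟩ := exists_injective_subquotient (B := f (i + 1)) (A' := (f i).map φ)
        (B' := (f (i + 1)).map φ) φ
        (fun x hx => Submodule.mem_map_of_mem hx) (fun x _ => by
          simp [hφ.eq_iff])
      exact ⟨β, hβ, ih β hβ hK ψ hψ⟩

theorem KrullClass.of_subsingleton [Subsingleton M] (α : WithBot Ordinal.{v}) :
    KrullClass R α M := by
  by_cases hα : α = ⊥
  · subst hα; rwa [krullClass_bot_iff]
  · rw [krullClass_iff hα]
    intro f _
    refine Filter.Eventually.of_forall fun i => ⟨⊥, bot_lt_iff_ne_bot.2 hα, ?_⟩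
    rw [krullClass_bot_iff]
    infer_instance

theorem KrullClass.mono {α β : WithBot Ordinal.{v}} (h : KrullClass R α M) (hαβ : α ≤ β) :
    KrullClass R β M := by
  by_cases hα : α = ⊥
  · subst hα
    rw [krullClass_bot_iff] at h
    exact .of_subsingleton β
  · rw [krullClass_iff hα] at h
    rw [krullClass_iff (ne_bot_of_le_ne_bot hα hαβ)]
    intro f hf
    filter_upwards [h f hf] with i ⟨γ, hγ, hK⟩
    exact ⟨γ, hγ.trans_le hαβ, hK⟩

theorem KrullClass.eventually {α : WithBot Ordinal.{v}} {P : Submodule R M}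
    (h : KrullClass R α P) (hα : α ≠ ⊥) {f : ℕ → Submodule R M} (hf : Antitone f)
    (hP : f 0 ≤ P) :
    ∀ᶠ i in Filter.atTop, ∃ β < α, KrullClass R β (↥(f i) ⧸ (f (i + 1)).submoduleOf (f i)) := by
  rw [krullClass_iff hα] at h
  filter_upwards [h (fun i => (f i).comap P.subtype) fun i j hij => Submodule.comap_mono (hf hij)]
    with i ⟨β, hβ, hK⟩
  have hi : f i ≤ P := (hf (Nat.zero_le i)).trans hP
  let l : f i →ₗ[R] (f i).comap P.subtype :=
    LinearMap.codRestrict _ (Submodule.inclusion hi) fun x => x.2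
  exact ⟨β, hβ, hK.of_injective _ (Submodule.mapQ_injective_of_comap_eq
    ((f (i + 1)).submoduleOf (f i)) _ l (by ext x; rfl))⟩

theorem krullDimModule_le_iff (α : WithBot Ordinal.{v}) :
    krullDimModule R M ≤ (α : WithTop (WithBot Ordinal.{v})) ↔ KrullClass R α M := by
  unfold krullDimModule
  split_ifs with h
  · rw [WithTop.coe_le_coe]
    refine ⟨fun hα => ?_, fun hα => not_lt.1 (WellFounded.not_lt_min wellFounded_lt
      {α : WithBot Ordinal.{v} | KrullClass R α M} hα)⟩
    exact KrullClass.mono (WellFounded.min_mem wellFounded_lt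
      {α : WithBot Ordinal.{v} | KrullClass R α M} h) hα
  · simp only [top_le_iff, WithTop.coe_ne_top, false_iff]
    exact fun hα => h ⟨α, hα⟩

theorem subsingleton_quotient_submoduleOf_iff {A B : Submodule R M} :
    Subsingleton (A ⧸ B.submoduleOf A) ↔ A ≤ B := by
  rw [Submodule.Quotient.subsingleton_iff, Submodule.submoduleOf,
    Submodule.comap_subtype_eq_top]

theorem isArtinian_of_forall_antitone
    (h : ∀ f : ℕ → Submodule R M, Antitone f → ∃ i, f i ≤ f (i + 1)) : IsArtinian R M := by
  refine ⟨wellFounded_iff_isEmpty_descending_chain.2 ⟨fun ⟨f, hf⟩ => ?_⟩⟩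
  obtain ⟨i, hi⟩ := h f (antitone_nat_of_succ_le fun n => (hf n).le)
  exact (hf i).not_ge hi

theorem krullClass_zero_iff : KrullClass R (0 : WithBot Ordinal.{v}) M ↔ IsArtinian R M := by
  have h0 : (0 : WithBot Ordinal.{v}) ≠ ⊥ := WithBot.coe_ne_bot
  have key (β : WithBot Ordinal.{v}) : β < 0 ↔ β = ⊥ := by
    refine ⟨fun h => ?_, fun h => h ▸ bot_lt_iff_ne_bot.2 h0⟩
    by_contra hβ
    obtain ⟨γ, rfl⟩ := WithBot.ne_bot_iff_exists.1 hβ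
    rw [← WithBot.coe_zero, WithBot.coe_lt_coe] at h
    exact not_lt_zero h
  simp only [krullClass_iff h0, key, exists_eq_left, krullClass_bot_iff,
    subsingleton_quotient_submoduleOf_iff]
  refine ⟨fun h => isArtinian_of_forall_antitone fun f hf => (h f hf).exists, fun h f hf => ?_⟩
  obtain ⟨n, hn⟩ := IsArtinian.monotone_stabilizes (R := R) (M := M) ⟨fun i => f i, hf⟩
  filter_upwards [Filter.eventually_ge_atTop n] with i hi
  exact le_of_eq ((hn i hi).symm.trans (hn (i + 1) (by omega)))

theorem WithBot.lt_one_iff_le_zero {β : WithBot Ordinal.{v}} : β < 1 ↔ β ≤ 0 := by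
  induction β with
  | bot => simp
  | coe γ =>
    rw [← WithBot.coe_one, ← WithBot.coe_zero, WithBot.coe_lt_coe, WithBot.coe_le_coe]
    simp

theorem krullClass_one_iff : KrullClass R (1 : WithBot Ordinal.{v}) M ↔
    ∀ f : ℕ → Submodule R M, Antitone f →
      ∀ᶠ i in Filter.atTop, IsArtinian R (↥(f i) ⧸ (f (i + 1)).submoduleOf (f i)) := by
  have h1 : (1 : WithBot Ordinal.{v}) ≠ ⊥ := WithBot.coe_ne_bot
  rw [krullClass_iff h1]
  refine forall₂_congr fun f _ => Filter.eventually_congr (.of_forall fun i => ?_)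
  rw [← krullClass_zero_iff]
  exact ⟨fun ⟨β, hβ, h⟩ => h.mono (WithBot.lt_one_iff_le_zero.1 hβ),
    fun h => ⟨0, WithBot.lt_one_iff_le_zero.2 le_rfl, h⟩⟩

/-- Noetherian induction on `P`. If `f (i + 1)` is nonzero in `M ⧸ P`, its preimage `Q` is strictly
larger than `P` and the factor `f i / f (i + 1)` embeds in `M ⧸ Q`. Any index above a common bound
for these quotients therefore works. -/
theorem HasKrullDim.of_isNoetherian [IsNoetherian R M] : HasKrullDim R M := by
  suffices h : ∀ P : Submodule R M, HasKrullDim R (M ⧸ P) by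
    obtain ⟨α, hα⟩ := h ⊥
    exact ⟨α, hα.of_injective _ (Submodule.quotEquivOfEqBot ⊥ rfl).symm.injective⟩
  intro P
  induction P using WellFoundedGT.induction with
  | ind P ih =>
    choose! κ hκ using ih
    obtain ⟨α, hα⟩ : BddAbove (Set.range κ) := by
      let κ' : Submodule R M → Ordinal.{v} := fun Q => (κ Q).unbotD 0
      obtain ⟨a, ha⟩ := Ordinal.bddAbove_of_small (s := Set.range κ')
      refine ⟨a, ?_⟩
      rintro _ ⟨Q, rfl⟩
      have h2 : κ' Q ≤ a := ha ⟨Q, rfl⟩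
      exact WithBot.unbotD_le_iff (by simp) |>.1 h2
    have hlt : ∃ α' : WithBot Ordinal.{v}, α < α' := exists_gt α
    obtain ⟨α', hα'⟩ := hlt
    refine ⟨α', (krullClass_iff (ne_bot_of_gt hα')).2 fun f hf => ?_⟩
    by_cases hbot : ∃ n, f n = ⊥
    · obtain ⟨n, hn⟩ := hbot
      filter_upwards [Filter.eventually_ge_atTop n] with i hi
      refine ⟨⊥, bot_lt_of_lt hα', ?_⟩
      rw [krullClass_bot_iff, subsingleton_quotient_submoduleOf_iff]
      exact (hf hi).trans (hn ▸ bot_le)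
    · push Not at hbot
      refine .of_forall fun i => ⟨α, hα', ?_⟩
      set Q := (f (i + 1)).comap P.mkQ with hQ
      have hPQ : P < Q := by
        refine lt_of_le_of_ne ?_ fun h => hbot (i + 1) ?_
        · intro x hx
          simp [hQ, (Submodule.Quotient.mk_eq_zero P).2 hx]
        · rw [← Submodule.map_comap_eq_of_surjective P.mkQ_surjective (f (i + 1)), ← hQ, ← h]
          simp
      have hK := (hκ Q hPQ).mono (hα ⟨Q, rfl⟩)
      have hK' : KrullClass R α ((M ⧸ P) ⧸ f (i + 1)) := by
        refine hK.of_injective (((f (i + 1)).liftQ (P.liftQ Q.mkQ ?_) ?_)) ?_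
        · simpa using hPQ.le
        · intro x hx
          obtain ⟨y, rfl⟩ := P.mkQ_surjective x
          simpa [hQ] using hx
        · rw [← LinearMap.ker_eq_bot, LinearMap.ker_eq_bot']
          intro z hz
          obtain ⟨x, rfl⟩ := (f (i + 1)).mkQ_surjective z
          obtain ⟨y, rfl⟩ := P.mkQ_surjective x
          simpa [hQ] using hz
      exact hK'.of_injective _ (Submodule.mapQ_injective_of_comap_eq _ _ (f i).subtype rfl)

/-- Every nonzero module with Krull dimension has a critical submodule. -/
theorem KrullClass.exists_critical [Nontrivial M] {α : WithBot Ordinal.{v}}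
    (h : KrullClass R α M) :
    ∃ (β : WithBot Ordinal.{v}) (C : Submodule R M), C ≠ ⊥ ∧
      (∀ D ≤ C, D ≠ ⊥ → ∀ γ < β, ¬ KrullClass R γ D) ∧
      (∀ D ≤ C, D ≠ ⊥ → ∃ γ < β, KrullClass R γ (C ⧸ D.submoduleOf C)) := by
  let T : Set (WithBot Ordinal.{v}) := {β | ∃ C : Submodule R M, C ≠ ⊥ ∧ KrullClass R β C}
  have hT : T.Nonempty :=
    ⟨α, ⊤, top_ne_bot, h.of_injective (⊤ : Submodule R M).subtype Subtype.val_injective⟩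
  -- `β` is minimal over all nonzero submodules. If no submodule in class `β` were critical, each
  -- would contain a nonzero one with quotient in no smaller class, and iteration would violate
  -- membership of `C₀` in class `β`.
  obtain ⟨β, ⟨C₀, hC₀, hK₀⟩, hmin⟩ := WellFounded.has_min wellFounded_lt T hT
  have hβ : β ≠ ⊥ := by
    rintro rfl
    rw [krullClass_bot_iff] at hK₀
    exact hC₀ ((Submodule.subsingleton_iff_eq_bot).1 hK₀)
  by_contra hcon
  push Not at hcon
  have step : ∀ C : {C : Submodule R M // C ≠ ⊥ ∧ KrullClass R β C},
      ∃ D : {C : Submodule R M // C ≠ ⊥ ∧ KrullClass R β C}, D.1 ≤ C.1 ∧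
        ∀ γ < β, ¬ KrullClass R γ (C.1 ⧸ D.1.submoduleOf C.1) := by
    rintro ⟨C, hC, hK⟩
    obtain ⟨D, hDC, hD, hγ⟩ := hcon β C hC fun D _ hD γ hγ hKD => hmin γ ⟨D, hD, hKD⟩ hγ
    exact ⟨⟨D, hD, hK.of_injective _ (Submodule.inclusion_injective hDC)⟩, hDC, hγ⟩
  choose g hg₁ hg₂ using step
  obtain ⟨f, hf₀, hf⟩ : ∃ f : ℕ → {C : Submodule R M // C ≠ ⊥ ∧ KrullClass R β C},
      f 0 = ⟨C₀, hC₀, hK₀⟩ ∧ ∀ n, f (n + 1) = g (f n) :=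
    ⟨fun n => g^[n] ⟨C₀, hC₀, hK₀⟩, rfl, fun n => Function.iterate_succ_apply' g n _⟩
  have hanti : Antitone fun n => (f n).1 := antitone_nat_of_succ_le fun n => by
    rw [hf]; exact hg₁ _
  obtain ⟨i, γ, hγ, hK⟩ := (hK₀.eventually hβ hanti (by simp [hf₀])).exists
  rw [hf] at hK
  exact hg₂ _ γ hγ hK

/-! ### Krull dimension excludes infinite direct sums -/

theorem not_krullClass_iSup_of_iSupIndep {P : ℕ → Submodule R M} (hP : iSupIndep P)
    (hne : ∀ n, P n ≠ ⊥) (α : WithBot Ordinal.{v}) (s : Set ℕ) (hs : s.Infinite) :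
    ¬ KrullClass R α (⨆ n ∈ s, P n : Submodule R M) := by
  induction α using WellFoundedLT.induction generalizing s with
  | ind α ih =>
    intro hK
    by_cases hα : α = ⊥
    · subst hα
      rw [krullClass_bot_iff, Submodule.subsingleton_iff_eq_bot] at hK
      obtain ⟨n, hn⟩ := hs.nonempty
      simp only [iSup_eq_bot] at hK
      exact hne n (hK n hn)
    · let e : ℕ ↪ s := hs.natEmbedding
      have he : Function.Injective fun n => (e n : ℕ) :=
        Subtype.val_injective.comp e.injective
      -- Passing from multiples of `2 ^ k` to multiples of `2 ^ (k + 1)` discards infinitely many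
      -- indices, so every factor of the chain contains another infinite direct sum, and induction
      -- on `α` applies.
      let t : ℕ → Set ℕ := fun k => (fun n => (e n : ℕ)) '' {n | 2 ^ k ∣ n}
      have ht : Antitone t := fun i j hij => Set.image_mono fun n hn =>
        (pow_dvd_pow 2 hij).trans hn
      have hmono {a b : Set ℕ} (hab : a ⊆ b) : ⨆ n ∈ a, P n ≤ ⨆ n ∈ b, P n :=
        biSup_mono fun n hn => hab hn
      obtain ⟨i, β, hβ, hKβ⟩ := (hK.eventually hα (f := fun k => ⨆ n ∈ t k, P n)
        (fun i j hij => hmono (ht hij)) (hmono (by rintro _ ⟨n, -, rfl⟩; exact (e n).2))).exists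
      have hinf : (t i \ t (i + 1)).Infinite := by
        have : (fun n => (e n : ℕ)) '' (Set.range fun m => 2 ^ i * (2 * m + 1)) ⊆
            t i \ t (i + 1) := by
          rintro _ ⟨_, ⟨m, rfl⟩, rfl⟩
          refine ⟨⟨_, Dvd.intro _ rfl, rfl⟩, ?_⟩
          rintro ⟨k, hk, hk'⟩
          have hk'' := he hk'
          subst hk''
          rw [Set.mem_ofPred_eq, pow_succ] at hk
          have := Nat.dvd_of_mul_dvd_mul_left (by positivity) hk
          omega
        refine Set.Infinite.mono this (Set.Infinite.image he.injOn
          (Set.infinite_range_of_injective fun a b hab => ?_))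
        have h2 : 2 ^ i * (2 * a + 1) = 2 ^ i * (2 * b + 1) := hab
        have := Nat.eq_of_mul_eq_mul_left (by positivity) h2
        omega
      have hdisj : Disjoint (⨆ n ∈ t i \ t (i + 1), P n) (⨆ n ∈ t (i + 1), P n) :=
        hP.disjoint_biSup_biSup Set.disjoint_sdiff_left
      have hle : (⨆ n ∈ t i \ t (i + 1), P n) ≤ ⨆ n ∈ t i, P n := hmono Set.sdiff_subset
      refine ih β hβ _ hinf (hKβ.of_injective
        ((Submodule.mkQ _).comp (Submodule.inclusion hle)) ?_)
      rw [← LinearMap.ker_eq_bot, LinearMap.ker_eq_bot']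
      rintro ⟨x, hx⟩ hx'
      have hx2 : x ∈ ⨆ n ∈ t (i + 1), P n := by
        rw [LinearMap.comp_apply, Submodule.mkQ_apply, Submodule.Quotient.mk_eq_zero] at hx'
        exact hx'
      exact Subtype.ext (Submodule.disjoint_def.1 hdisj x hx hx2)

/-- In a vanishing sum the terms before `i` are zero by induction and those after `i` lie in `f (i +
1)`, which meets `D i` trivially. -/
theorem iSupIndep_of_antitone {f D : ℕ → Submodule R M} (hf : Antitone f)
    (hD : ∀ i, D i ≤ f i) (hdisj : ∀ i, Disjoint (D i) (f (i + 1))) : iSupIndep D := by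
  rw [iSupIndep_iff_finsetSum_eq_zero_imp_eq_zero]
  intro s v hv hsum i
  induction i using Nat.strong_induction_on with
  | _ i ih =>
    intro hi
    have h1 : v i = - ∑ j ∈ s.erase i, v j := by
      rw [← Finset.add_sum_erase s v hi] at hsum
      exact eq_neg_of_add_eq_zero_left hsum
    refine Submodule.disjoint_def.1 (hdisj i) _ (hv i hi) ?_
    rw [h1]
    refine neg_mem (sum_mem fun j hj => ?_)
    rw [Finset.mem_erase] at hj
    rcases lt_or_gt_of_ne hj.1 with h | h
    · rw [ih j h hj.2]; exact zero_mem _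
    · exact hf (Nat.succ_le_of_lt h) (hD j (hv j hj.2))

theorem HasKrullDim.exists_eq_bot (h : HasKrullDim R M) {f D : ℕ → Submodule R M}
    (hf : Antitone f) (hD : ∀ i, D i ≤ f i) (hdisj : ∀ i, Disjoint (D i) (f (i + 1))) :
    ∃ i, D i = ⊥ := by
  by_contra! hne
  obtain ⟨α, hα⟩ := h
  exact not_krullClass_iSup_of_iSupIndep (iSupIndep_of_antitone hf hD hdisj) hne α Set.univ
    Set.infinite_univ (hα.of_injective (Submodule.subtype _) Subtype.val_injective)

end KrullClass
-- Goldie theory: essential left ideals and regular elements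
section LeftIdeals

variable {S : Type u} [Ring S]

/-- A left ideal is essential if it meets every nonzero left ideal. -/
def IsEssentialLeftIdeal (E : Ideal S) : Prop :=
  ∀ x : S, x ≠ 0 → ∃ r : S, r * x ≠ 0 ∧ r * x ∈ E

/-- The left annihilator of an element. -/
def leftAnnihilator (c : S) : Ideal S :=
  LinearMap.ker (LinearMap.toSpanSingleton S S c)

theorem mem_leftAnnihilator {c x : S} : x ∈ leftAnnihilator c ↔ x * c = 0 := by
  simp [leftAnnihilator]

theorem isRightRegular_iff_forall {c : S} : IsRightRegular c ↔ ∀ x, x * c = 0 → x = 0 :=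
  isRightRegular_iff_left_eq_zero_of_mul

theorem IsSemiprimeRing.exists_mul_mul_ne_zero (hS : IsSemiprimeRing S) {b : S} (hb : b ≠ 0) :
    ∃ r, b * r * b ≠ 0 := by
  by_contra! h
  exact hb (hS b h)

/-- In a semiprime ring with Krull dimension every nonzero left ideal contains a nonzero left ideal
on which right multiplication by one of its elements is injective. -/
theorem IsSemiprimeRing.exists_injective_mul (hS : IsSemiprimeRing S) (hK : HasKrullDim S S)
    {I : Ideal S} (hI : I ≠ ⊥) :
    ∃ D ≤ I, D ≠ ⊥ ∧ ∃ a ∈ D, ∀ x ∈ D, x * a = 0 → x = 0 := by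
  obtain ⟨α, hα⟩ := hK
  have := Submodule.nontrivial_iff_ne_bot.2 hI
  obtain ⟨β, C, hC, hsub, hquot⟩ :=
    (hα.of_injective I.subtype Subtype.val_injective).exists_critical
  obtain ⟨b, hb, hb0⟩ := Submodule.exists_mem_ne_zero_of_ne_bot hC
  obtain ⟨r, hr⟩ := hS.exists_mul_mul_ne_zero (b := (b : S)) (by simpa using hb0)
  let φ : C →ₗ[S] I := (LinearMap.toSpanSingleton S I (r • b)).comp (I.subtype.comp C.subtype)
  have hφ (x : C) : (φ x : S) = x * (r * b) := rfl
  have hrange : LinearMap.range φ ≤ C := by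
    rintro _ ⟨x, rfl⟩
    exact C.smul_mem _ (C.smul_mem r hb)
  have hrange0 : LinearMap.range φ ≠ ⊥ := by
    intro h
    have h0 : φ ⟨b, hb⟩ = 0 := by
      rw [LinearMap.range_eq_bot.1 h]; rfl
    apply hr
    have := congrArg Subtype.val h0
    rw [hφ] at this
    simpa [mul_assoc] using this
  -- Otherwise `C / ker φ`, isomorphic to the nonzero submodule `range φ` of the critical module
  -- `C`, would have dimension below `β`.
  have hker : LinearMap.ker φ = ⊥ := by
    by_contra hne
    obtain ⟨γ, hγ, hKγ⟩ := hquot ((LinearMap.ker φ).map C.subtype) (Submodule.map_subtype_le _ _)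
      (by
        rwa [(Submodule.map_injective_of_injective C.injective_subtype).ne_iff'
          (Submodule.map_bot _)])
    rw [Submodule.submoduleOf, Submodule.comap_map_eq_of_injective C.injective_subtype] at hKγ
    exact hsub _ hrange hrange0 γ hγ
      (hKγ.of_injective _ φ.quotKerEquivRange.symm.injective)
  refine ⟨C.map I.subtype, Submodule.map_subtype_le _ _, ?_, r * b, ?_, ?_⟩
  · rwa [(Submodule.map_injective_of_injective I.injective_subtype).ne_iff' (Submodule.map_bot _)]
  · exact ⟨r • b, C.smul_mem r hb, rfl⟩
  · rintro _ ⟨x, hx, rfl⟩ h0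
    have : (⟨x, hx⟩ : C) ∈ LinearMap.ker φ := Subtype.ext h0
    rw [hker, Submodule.mem_bot] at this
    simpa using congrArg (fun y : C => ((y : I) : S)) this

/-- A semiprime ring with left Krull dimension is left nonsingular. -/
theorem IsEssentialLeftIdeal.eq_zero_of_forall_mul_eq_zero {E : Ideal S}
    (hE : IsEssentialLeftIdeal E) (hS : IsSemiprimeRing S) (hK : HasKrullDim S S) {z : S}
    (hz : ∀ e ∈ E, e * z = 0) : z = 0 := by
  by_contra hz0
  obtain ⟨D, hDz, hD, a, ha, hinj⟩ := hS.exists_injective_mul hK (I := Ideal.span {z})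
    (by simpa using hz0)
  obtain ⟨s, rfl⟩ := Ideal.mem_span_singleton'.1 (hDz ha)
  obtain ⟨d, hd, hd0⟩ := Submodule.exists_mem_ne_zero_of_ne_bot hD
  by_cases hds : d * s = 0
  · exact hd0 (hinj d hd (by rw [← mul_assoc, hds, zero_mul]))
  · obtain ⟨r, hr0, hrE⟩ := hE _ hds
    have : r * d = 0 := hinj _ (D.smul_mem r hd) (by
      rw [← hz _ hrE]; simp only [mul_assoc])
    exact hr0 (by rw [← mul_assoc, this, zero_mul])

/-- Elements `c ∈ E` with `l(c²) = l(c)`, where `l` is the left annihilator, are improved starting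
from `0`. If `c` is not right regular, then `E ∩ l(c) ≠ 0` contains some `D` and `a ∈ D` with right
multiplication by `a` injective on `D`. As `ac = 0`, `l(c + a) = l(c) ∩ l(a)` meets `D` trivially.
The successive `D` would form an infinite direct sum. -/
theorem IsEssentialLeftIdeal.exists_isRightRegular {E : Ideal S}
    (hE : IsEssentialLeftIdeal E) (hS : IsSemiprimeRing S) (hK : HasKrullDim S S) :
    ∃ c ∈ E, IsRightRegular c := by
  by_contra! hcon
  let T := {c : S // c ∈ E ∧ ∀ x, x * c * c = 0 → x * c = 0}
  have step : ∀ c : T, ∃ c' : T, ∃ D : Ideal S, D ≠ ⊥ ∧ D ≤ leftAnnihilator c.1 ∧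
      leftAnnihilator c'.1 ≤ leftAnnihilator c.1 ∧ Disjoint D (leftAnnihilator c'.1) := by
    rintro ⟨c, hc, hcc⟩
    have hne : E ⊓ leftAnnihilator c ≠ ⊥ := by
      intro hbot
      refine hcon c hc (isRightRegular_iff_forall.2 fun x hx => ?_)
      by_contra hx0
      obtain ⟨r, hr0, hr⟩ := hE x hx0
      refine hr0 ((Submodule.eq_bot_iff _).1 hbot _ ⟨hr, ?_⟩)
      rw [SetLike.mem_coe, mem_leftAnnihilator, mul_assoc, hx, mul_zero]
    obtain ⟨D, hDI, hD, a, ha, hinj⟩ := hS.exists_injective_mul hK hne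
    have hac : a * c = 0 := mem_leftAnnihilator.1 (hDI ha).2
    have key {x : S} (hx : x * (c + a) = 0) : x * c = 0 ∧ x * a = 0 := by
      have h1 : x * c = 0 := hcc x (by
        have : x * (c + a) * c = 0 := by rw [hx, zero_mul]
        rwa [mul_add, add_mul, mul_assoc x a, hac, mul_zero, add_zero] at this)
      rw [mul_add, h1, zero_add] at hx
      exact ⟨h1, hx⟩
    refine ⟨⟨c + a, E.add_mem hc (hDI ha).1, fun x hx => ?_⟩, D, hD, fun x hx => (hDI hx).2, ?_,
      ?_⟩
    · obtain ⟨h1, h2⟩ := key hx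
      rw [mul_add, add_mul, mul_assoc x a, hac, mul_zero, add_zero] at h1
      have h3 := hcc x h1
      rw [mul_add, h3, zero_add] at h2 ⊢
      exact hinj _ (D.smul_mem x ha) h2
    · intro x hx
      rw [mem_leftAnnihilator] at hx ⊢
      exact (key hx).1
    · rw [Submodule.disjoint_def]
      intro x hxD hx
      exact hinj x hxD (key (mem_leftAnnihilator.1 hx)).2
  choose g D hD hDle hanti hdisj using step
  obtain ⟨f, hf⟩ : ∃ f : ℕ → T, ∀ n, f (n + 1) = g (f n) :=
    ⟨fun n => g^[n] ⟨0, E.zero_mem, by simp⟩, fun n => Function.iterate_succ_apply' g n _⟩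
  obtain ⟨i, hi⟩ := hK.exists_eq_bot (f := fun n => leftAnnihilator (f n).1)
    (D := fun n => D (f n)) (antitone_nat_of_succ_le fun n => by rw [hf]; exact hanti _)
    (fun n => hDle _) (fun n => by rw [hf]; exact hdisj _)
  exact hD _ hi

/-- If `Sx ∩ Sc = 0` with `x ≠ 0`, then the left ideals `Sxcⁿ` are nonzero and independent. -/
theorem IsRightRegular.isEssentialLeftIdeal_span (hK : HasKrullDim S S) {c : S}
    (hc : IsRightRegular c) : IsEssentialLeftIdeal (Ideal.span {c}) := by
  intro x hx
  by_contra! hcon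
  obtain ⟨i, hi⟩ := hK.exists_eq_bot (f := fun n => Ideal.span {c ^ n})
    (D := fun n => Ideal.span {x * c ^ n})
    (antitone_nat_of_succ_le fun n => by
      rw [Ideal.span_singleton_le_iff_mem, Ideal.mem_span_singleton']
      exact ⟨c, (pow_succ' c n).symm⟩)
    (fun n => by
      rw [Ideal.span_singleton_le_iff_mem, Ideal.mem_span_singleton']
      exact ⟨x, rfl⟩)
    (fun n => by
      rw [Submodule.disjoint_def]
      intro y hy hy'
      obtain ⟨r, rfl⟩ := Ideal.mem_span_singleton'.1 hy
      obtain ⟨s, hs⟩ := Ideal.mem_span_singleton'.1 hy'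
      have h1 : s * c = r * x := (hc.pow n) (by
        simp only [mul_assoc, ← pow_succ', hs])
      have h2 : r * x = 0 := by
        by_contra h
        exact hcon r h (Ideal.mem_span_singleton'.2 ⟨s, h1⟩)
      rw [← mul_assoc, h2, zero_mul])
  have h0 : x * c ^ i = 0 := by simpa using hi
  exact hx (isRightRegular_iff_forall.1 (hc.pow i) x h0)

theorem IsRightRegular.isRegular (hS : IsSemiprimeRing S) (hK : HasKrullDim S S) {c : S}
    (hc : IsRightRegular c) : IsRegular c := by
  refine ⟨isLeftRegular_iff_right_eq_zero_of_mul.2 fun z hz => ?_, hc⟩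
  refine (hc.isEssentialLeftIdeal_span hK).eq_zero_of_forall_mul_eq_zero hS hK fun e he => ?_
  obtain ⟨r, rfl⟩ := Ideal.mem_span_singleton'.1 he
  rw [mul_assoc, hz, mul_zero]

theorem IsRegular.of_mul (hS : IsSemiprimeRing S) (hK : HasKrullDim S S) {d a : S}
    (h : IsRegular (d * a)) : IsRegular d ∧ IsRegular a := by
  have hda := isRightRegular_iff_forall.1 h.right
  have hd : IsRightRegular d := isRightRegular_iff_forall.2 fun x hx => hda x (by
    rw [← mul_assoc, hx, zero_mul])
  refine ⟨hd.isRegular hS hK, IsRightRegular.isRegular hS hK (isRightRegular_iff_forall.2 ?_)⟩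
  intro x hx
  by_contra hx0
  -- Essentiality of `Sd` gives `0 ≠ rx = yd`; then `yda = rxa = 0` forces `y = 0`.
  obtain ⟨r, hr0, hr⟩ := hd.isEssentialLeftIdeal_span hK x hx0
  obtain ⟨y, hy⟩ := Ideal.mem_span_singleton'.1 hr
  have hy0 : y = 0 := hda y (by rw [← mul_assoc, hy, mul_assoc, hx, mul_zero])
  exact hr0 (by rw [← hy, hy0, zero_mul])

theorem IsRegular.mul_eq_one_comm {a b : S} (ha : IsRegular a) (h : a * b = 1) : b * a = 1 :=
  ha.left (by simp only [← mul_assoc, h, one_mul, mul_one])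

theorem IsRegular.mul_eq_one_comm' {a b : S} (ha : IsRegular a) (h : b * a = 1) : a * b = 1 :=
  ha.right (by simp only [mul_assoc, h, one_mul, mul_one])

/-! ### Principality of left ideals -/

/-- The ascending chain condition on principal right ideals generated by regular elements, in terms
of generators. -/
def RegularACC (S : Type u) [Ring S] : Prop :=
  ∀ d a : ℕ → S, (∀ n, IsRegular (d n)) → (∀ n, d n = d (n + 1) * a n) →
    ∃ n u, d (n + 1) = d n * u

theorem IsEssentialLeftIdeal.exists_eq_span {E : Ideal S} (hE : IsEssentialLeftIdeal E)
    (hS : IsSemiprimeRing S) (hK : HasKrullDim S S) (hacc : RegularACC S)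
    (hmax : MaximalLeftIdealsPrincipal S) : ∃ a, E = Ideal.span {a} := by
  by_contra! hcon
  obtain ⟨c, hcE, hc⟩ := hE.exists_isRightRegular hS hK
  let T := {p : Ideal S × S // p.2 ∈ p.1 ∧ IsRegular p.2 ∧ ∀ a, p.1 ≠ Ideal.span {a}}
  have step : ∀ p : T, ∃ q : T, ∃ a, IsRegular a ∧ (∀ u, u * a ≠ 1) ∧ p.1.2 = q.1.2 * a := by
    rintro ⟨⟨I, d⟩, hdI, hd, hI⟩
    obtain ⟨m, hm, hIm⟩ := Ideal.exists_le_maximal I (by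
      rintro rfl
      exact hI 1 Ideal.span_singleton_one.symm)
    obtain ⟨a, ha⟩ := (hmax m hm).principal
    have hmem {x : S} (hx : x ∈ I) : ∃ y, y * a = x := by
      have := hIm hx
      rw [ha] at this
      exact Ideal.mem_span_singleton'.1 this
    obtain ⟨d', rfl⟩ := hmem hdI
    obtain ⟨hd', ha'⟩ := hd.of_mul hS hK
    refine ⟨⟨⟨Submodule.comap (LinearMap.toSpanSingleton S S a) I, d'⟩, by simpa using hdI, hd', ?_⟩, a, ha',
      ?_, rfl⟩
    · intro b hb
      change Submodule.comap (LinearMap.toSpanSingleton S S a) I = Ideal.span {b} at hb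
      refine hI (b * a) (le_antisymm ?_ ?_)
      · intro x hx
        obtain ⟨y, rfl⟩ := hmem hx
        have hy : y ∈ Submodule.comap (LinearMap.toSpanSingleton S S a) I := by simpa using hx
        have hb' : y ∈ Ideal.span {b} := hb ▸ hy
        obtain ⟨r, rfl⟩ := Ideal.mem_span_singleton'.1 hb'
        exact Ideal.mem_span_singleton'.2 ⟨r, (mul_assoc r b a).symm⟩
      · rw [Ideal.span_singleton_le_iff_mem]
        have hb' : b ∈ Submodule.comap (LinearMap.toSpanSingleton S S a) I :=
          hb ▸ Ideal.mem_span_singleton_self b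
        simpa using hb'
    · intro r hr
      refine hm.ne_top ((Ideal.eq_top_iff_one m).2 ?_)
      rw [ha, ← hr]
      exact Ideal.mem_span_singleton'.2 ⟨r, rfl⟩
  choose g a hreg hunit hg using step
  obtain ⟨f, hf⟩ : ∃ f : ℕ → T, ∀ n, f (n + 1) = g (f n) :=
    ⟨fun n => g^[n] ⟨(E, c), hcE, hc.isRegular hS hK, hcon⟩,
      fun n => Function.iterate_succ_apply' g n _⟩
  obtain ⟨n, r, hr⟩ := hacc (fun n => (f n).1.2) (fun n => a (f n)) (fun n => (f n).2.2.1)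
    fun n => by rw [hf]; exact hg _
  -- Stabilization `d (n + 1) = d n * r` makes `a` invertible, although `Sa` is a proper ideal.
  refine hunit (f n) r ((hreg (f n)).mul_eq_one_comm ?_)
  have h1 := hg (f n)
  rw [← hf] at h1
  refine (f (n + 1)).2.2.1.left ?_
  change (f (n + 1)).1.2 * (a (f n) * r) = (f (n + 1)).1.2 * 1
  rw [← mul_assoc, ← h1, mul_one]
  exact hr.symm

theorem exists_disjoint_isEssentialLeftIdeal_sup (I : Ideal S) :
    ∃ C : Ideal S, Disjoint I C ∧ IsEssentialLeftIdeal (I ⊔ C) := by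
  obtain ⟨C, -, hC⟩ := zorn_le_nonempty₀ {C : Ideal S | Disjoint I C}
    (fun c hc hchain y hy => ⟨sSup c, by
      rw [Set.mem_ofPred_eq, hchain.directedOn.disjoint_sSup_right]
      exact fun b hb => hc hb, fun z hz => le_sSup hz⟩) ⊥ disjoint_bot_right
  refine ⟨C, hC.prop, fun x hx => ?_⟩
  by_contra! hcon
  have hdisj : Disjoint (I ⊔ C) (Ideal.span {x}) := by
    rw [Submodule.disjoint_def]
    intro y hy hyx
    obtain ⟨r, rfl⟩ := Ideal.mem_span_singleton'.1 hyx
    by_contra h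
    exact hcon r h hy
  have hle := hC.le_of_ge (y := C ⊔ Ideal.span {x})
    (hC.prop.disjoint_sup_right_of_disjoint_sup_left hdisj) le_sup_left
  have hxC : x ∈ C := hle (Submodule.mem_sup_right (Ideal.mem_span_singleton_self x))
  exact hcon 1 (by simpa using hx) (by simpa using Submodule.mem_sup_right hxC)

theorem isPLIR_of_maximalLeftIdealsPrincipal (hS : IsSemiprimeRing S) (hK : HasKrullDim S S)
    (hacc : RegularACC S) (hmax : MaximalLeftIdealsPrincipal S) : IsPLIR S := by
  intro I
  obtain ⟨C, hdisj, hess⟩ := exists_disjoint_isEssentialLeftIdeal_sup I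
  obtain ⟨a, ha⟩ := hess.exists_eq_span hS hK hacc hmax
  have haI : a ∈ I ⊔ C := ha ▸ Ideal.mem_span_singleton_self a
  obtain ⟨i, hi, c, hc, rfl⟩ := Submodule.mem_sup.1 haI
  refine ⟨i, le_antisymm (fun y hy => ?_) ((Ideal.span_singleton_le_iff_mem I).2 hi)⟩
  have hy' : y ∈ Ideal.span {i + c} := ha ▸ Submodule.mem_sup_left hy
  obtain ⟨r, rfl⟩ := Ideal.mem_span_singleton'.1 hy'
  have h0 : r * c = 0 := Submodule.disjoint_def.1 hdisj _ (by
    have := I.sub_mem hy (I.smul_mem r hi)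
    simpa [mul_add] using this) (C.smul_mem r hc)
  rw [mul_add, h0, add_zero]
  exact Ideal.mem_span_singleton'.2 ⟨r, rfl⟩

/-! ### Krull dimension at most one -/

theorem IsEssentialLeftIdeal.isArtinian_quotient {F : Ideal S} (hF : IsEssentialLeftIdeal F)
    (hS : IsSemiprimeRing S) (hK : HasKrullDim S S) (hacc : RegularACC S) (hP : IsPLIR S) :
    IsArtinian S (S ⧸ F) := by
  obtain ⟨c, hcF, hc⟩ := hF.exists_isRightRegular hS hK
  replace hc := hc.isRegular hS hK
  refine isArtinian_of_forall_antitone fun f hf => ?_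
  -- The chain lifts to left ideals `S aₙ` containing `c`. With `c = dₙaₙ` and `aₙ₊₁ = bₙaₙ`,
  -- cancellation gives `dₙ = dₙ₊₁bₙ`, so descent of the `S aₙ` becomes ascent of the `dₙS`.
  choose a ha using fun n => (hP ((f n).comap F.mkQ)).principal
  replace ha (n : ℕ) : (f n).comap F.mkQ = Ideal.span {a n} := ha n
  have hcf (n : ℕ) : c ∈ Ideal.span {a n} := ha n ▸ Submodule.le_comap_mkQ F _ hcF
  choose d hd using fun n => Ideal.mem_span_singleton'.1 (hcf n)
  have hab (n : ℕ) : a (n + 1) ∈ Ideal.span {a n} := by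
    rw [← ha]
    refine Submodule.comap_mono (hf n.le_succ) ?_
    rw [ha]
    exact Ideal.mem_span_singleton_self _
  choose b hb using fun n => Ideal.mem_span_singleton'.1 (hab n)
  have hreg (n : ℕ) : IsRegular (d n) ∧ IsRegular (a n) := IsRegular.of_mul hS hK (by rwa [hd])
  have hdb (n : ℕ) : d n = d (n + 1) * b n := (hreg n).2.right (by
    change d n * a n = d (n + 1) * b n * a n
    rw [mul_assoc, hb, hd, hd])
  obtain ⟨n, r, hr⟩ := hacc d b (fun n => (hreg n).1) hdb
  have hbr : b n * r = 1 := (hreg (n + 1)).1.left (by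
    change d (n + 1) * (b n * r) = d (n + 1) * 1
    rw [← mul_assoc, ← hdb, mul_one, hr])
  have hbn : IsRegular (b n) := by
    refine (IsRegular.of_mul hS hK (a := a n) ?_).1
    rw [hb]
    exact (hreg _).2
  have hrb := hbn.mul_eq_one_comm hbr
  refine ⟨n, (Submodule.comap_le_comap_iff_of_surjective F.mkQ_surjective).1 ?_⟩
  rw [ha, ha, Ideal.span_singleton_le_iff_mem]
  exact Ideal.mem_span_singleton'.2 ⟨r, by rw [← hb, ← mul_assoc, hrb, one_mul]⟩

theorem krullClass_one_of_isPLIR (hS : IsSemiprimeRing S) (hacc : RegularACC S)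
    (hP : IsPLIR S) : KrullClass S (1 : WithBot Ordinal.{u}) S := by
  have : IsPrincipalIdealRing S := ⟨hP⟩
  have hK : HasKrullDim S S := .of_isNoetherian
  refine krullClass_one_iff.2 fun f hf => ?_
  -- `D` is chosen nonzero unless `f (i + 1)` is essential in `f i`; independence of these choices
  -- then leaves only finitely many inessential steps.
  have hex (i : ℕ) : ∃ D : Ideal S, D ≤ f i ∧ Disjoint D (f (i + 1)) ∧
      (D = ⊥ → ∀ D' ≤ f i, Disjoint D' (f (i + 1)) → D' = ⊥) := by
    by_cases h : ∀ D' ≤ f i, Disjoint D' (f (i + 1)) → D' = ⊥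
    · exact ⟨⊥, bot_le, disjoint_bot_left, fun _ => h⟩
    · push Not at h
      obtain ⟨D', h1, h2, h3⟩ := h
      exact ⟨D', h1, h2, fun h => absurd h h3⟩
  choose D hDf hdisj hD using hex
  have hfin := WellFoundedGT.finite_ne_bot_of_iSupIndep (iSupIndep_of_antitone hf hDf hdisj)
  rw [← Nat.cofinite_eq_atTop]
  filter_upwards [hfin.compl_mem_cofinite] with i hi
  have hess := hD i (by simpa using hi)
  obtain ⟨C, hC, hCess⟩ := exists_disjoint_isEssentialLeftIdeal_sup (f (i + 1))
  have hCf : C ⊓ f i = ⊥ := hess _ inf_le_right (hC.symm.mono_left inf_le_left)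
  have := hCess.isArtinian_quotient hS hK hacc hP
  -- By the modular law `f i ∩ (f (i + 1) + C) = f (i + 1)`, so the factor embeds in the quotient by
  -- an essential left ideal.
  refine isArtinian_of_injective _ (Submodule.mapQ_injective_of_comap_eq
    ((f (i + 1)).submoduleOf (f i)) (f (i + 1) ⊔ C) (f i).subtype ?_)
  refine le_antisymm (fun x hx => ?_) (Submodule.comap_mono le_sup_left)
  obtain ⟨y, hy, z, hz, hyz⟩ := Submodule.mem_sup.1 (Submodule.mem_comap.1 hx)
  have hz0 : z = 0 := (Submodule.eq_bot_iff _).1 hCf z ⟨hz, by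
    have := (f i).sub_mem x.2 (hf i.le_succ hy)
    rwa [← Submodule.subtype_apply, ← hyz, add_sub_cancel_left] at this⟩
  rw [hz0, add_zero] at hyz
  exact Submodule.mem_comap.2 (hyz ▸ hy)

/-- Each factor of the chain `Sdⁿ` contains a copy of `S/Sd` through right multiplication by `dⁿ`,
and some factor is artinian. -/
theorem KrullClass.isArtinian_quotient_span (hK : KrullClass S (1 : WithBot Ordinal.{u}) S)
    {d : S} (hd : IsRightRegular d) : IsArtinian S (S ⧸ Ideal.span {d}) := by
  obtain ⟨n, hn⟩ := (krullClass_one_iff.1 hK (fun n => Ideal.span {d ^ n})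
    (antitone_nat_of_succ_le fun n => by
      rw [Ideal.span_singleton_le_iff_mem, Ideal.mem_span_singleton']
      exact ⟨d, (pow_succ' d n).symm⟩)).exists
  let l : S →ₗ[S] Ideal.span {d ^ n} :=
    (LinearMap.toSpanSingleton S S (d ^ n)).codRestrict _
      fun x => Ideal.mem_span_singleton'.2 ⟨x, rfl⟩
  refine isArtinian_of_injective _ (Submodule.mapQ_injective_of_comap_eq _
    ((Ideal.span {d ^ (n + 1)}).submoduleOf (Ideal.span {d ^ n})) l ?_)
  ext x
  change x * d ^ n ∈ Ideal.span {d ^ (n + 1)} ↔ _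
  simp only [Ideal.mem_span_singleton', pow_succ', ← mul_assoc]
  exact exists_congr fun y => (hd.pow n).eq_iff

theorem KrullClass.regularACC (hS : IsSemiprimeRing S)
    (hK : KrullClass S (1 : WithBot Ordinal.{u}) S) : RegularACC S := by
  intro d a hd hda
  have hK' : HasKrullDim S S := ⟨1, hK⟩
  have := hK.isArtinian_quotient_span (hd 0).right
  -- `p n = aₙ₋₁ ⋯ a₀`, so `d 0 = d n * p n`: the ascending chain of the `dₙS` becomes a descending
  -- chain of left ideals `S pₙ` above `S d₀`.
  let p : ℕ → S := fun n => Nat.rec 1 (fun n x => a n * x) n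
  have hp (n : ℕ) : p (n + 1) = a n * p n := rfl
  have hdp (n : ℕ) : d n * p n = d 0 := by
    induction n with
    | zero => exact mul_one _
    | succ n ih => rw [hp, ← mul_assoc, ← hda, ih]
  have hpreg (n : ℕ) : IsRegular (p n) :=
    (IsRegular.of_mul hS hK' (d := d n) (by rw [hdp]; exact hd 0)).2
  let f : ℕ → Submodule S (S ⧸ Ideal.span {d 0}) := fun n =>
    Submodule.map (Ideal.span {d 0}).mkQ (Ideal.span {p n})
  have hf : Antitone f := antitone_nat_of_succ_le fun n => Submodule.map_mono <| by
    rw [Ideal.span_singleton_le_iff_mem, Ideal.mem_span_singleton']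
    exact ⟨a n, rfl⟩
  obtain ⟨n, hn⟩ := IsArtinian.monotone_stabilizes
    (⟨f, hf⟩ : ℕ →o (Submodule S (S ⧸ Ideal.span {d 0}))ᵒᵈ)
  have heq : f n = f (n + 1) := hn (n + 1) n.le_succ
  have hmem : p n ∈ Ideal.span {d 0} ⊔ Ideal.span {p (n + 1)} := by
    rw [← Submodule.comap_map_mkQ]
    change (Ideal.span {d 0}).mkQ (p n) ∈ f (n + 1)
    rw [← heq]
    exact Submodule.mem_map_of_mem (Ideal.mem_span_singleton_self _)
  rw [sup_eq_right.2 (by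
    rw [Ideal.span_singleton_le_iff_mem, Ideal.mem_span_singleton']
    exact ⟨_, hdp (n + 1)⟩)] at hmem
  obtain ⟨x, hx⟩ := Ideal.mem_span_singleton'.1 hmem
  have hxa : x * a n = 1 := (hpreg n).right (by
    change x * a n * p n = 1 * p n
    rw [mul_assoc, ← hp, hx, one_mul])
  have han : IsRegular (a n) := (IsRegular.of_mul hS hK' (d := a n) (a := p n) (hpreg (n + 1))).1
  refine ⟨n, x, ?_⟩
  rw [hda n, mul_assoc, han.mul_eq_one_comm' hxa, mul_one]

end LeftIdeals

/-! ### Transfer between right ideals and the opposite ring -/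

section Opposite

open MulOpposite

variable {R : Type u} [Ring R]

/-- The right module `R_R` is the left module of the opposite ring over itself. -/
def rightRegularEquiv (R : Type u) [Ring R] : R ≃ₗ[Rᵐᵒᵖ] Rᵐᵒᵖ :=
  { opAddEquiv with map_smul' := fun _ _ => rfl }

theorem IsSemiprimeRing.op (hR : IsSemiprimeRing R) : IsSemiprimeRing Rᵐᵒᵖ := fun a ha =>
  unop_injective (hR a.unop fun r => by simpa [mul_assoc] using congrArg unop (ha (MulOpposite.op r)))

theorem krullClass_op_iff {α : WithBot Ordinal.{u}} :
    KrullClass Rᵐᵒᵖ α Rᵐᵒᵖ ↔ KrullClass Rᵐᵒᵖ α R :=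
  ⟨fun h => h.of_injective _ (rightRegularEquiv R).injective,
    fun h => h.of_injective _ (rightRegularEquiv R).symm.injective⟩

theorem Submodule.isPrincipal_map_equiv_iff {M N : Type*} [AddCommGroup M] [Module R M]
    [AddCommGroup N] [Module R N] (e : M ≃ₗ[R] N) {P : Submodule R M} :
    (P.map (e : M →ₗ[R] N)).IsPrincipal ↔ P.IsPrincipal := by
  refine ⟨fun h => ?_, fun h => h.map _⟩
  have := h.map (e.symm : N →ₗ[R] M)
  rwa [← Submodule.map_comp, LinearEquiv.symm_comp, Submodule.map_id] at this

theorem isPLIR_op_iff : IsPLIR Rᵐᵒᵖ ↔ IsPRIR R :=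
  ⟨fun h _ => (Submodule.isPrincipal_map_equiv_iff (rightRegularEquiv R)).1 (h _),
    fun h _ => (Submodule.isPrincipal_map_equiv_iff (rightRegularEquiv R).symm).1 (h _)⟩

theorem MaximalRightIdealsPrincipal.op (h : MaximalRightIdealsPrincipal R) :
    MaximalLeftIdealsPrincipal Rᵐᵒᵖ := fun I hI =>
  (Submodule.isPrincipal_map_equiv_iff (rightRegularEquiv R).symm).1
    (h _ ((OrderIso.isCoatom_iff (Submodule.orderIsoMapComap (rightRegularEquiv R).symm) I).2
      hI.out))

theorem LeftACCReg.op (h : LeftACCReg R) : RegularACC Rᵐᵒᵖ := by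
  intro d a hd hda
  have hreg (n : ℕ) : IsRegular (d n).unop := (hd n).unop
  obtain ⟨n, hn⟩ := h (fun n => Ideal.span {(d n).unop}) (monotone_nat_of_le_succ fun n => by
    rw [Ideal.span_singleton_le_iff_mem, Ideal.mem_span_singleton', hda n]
    exact ⟨_, (unop_mul _ _).symm⟩) fun n => ⟨_, hreg n, rfl⟩
  have hmem : (d (n + 1)).unop ∈ Ideal.span {(d n).unop} :=
    hn (n + 1) n.le_succ ▸ Ideal.mem_span_singleton_self _
  obtain ⟨x, hx⟩ := Ideal.mem_span_singleton'.1 hmem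
  exact ⟨n, MulOpposite.op x, unop_injective hx.symm⟩

theorem LeftACCReg.of_isNoetherian [IsNoetherian R R] : LeftACCReg R := fun f hf _ => by
  obtain ⟨n, hn⟩ := monotone_stabilizes_iff_noetherian.2 ‹_› ⟨f, hf⟩
  exact ⟨n, fun m hm => (hn m hm).symm⟩

theorem RegularACC.of_isPRIR (hP : IsPRIR R) : RegularACC R := by
  intro d a hd hda
  have : IsNoetherian Rᵐᵒᵖ R := ⟨fun I => by
    obtain ⟨x, hx⟩ := (hP I).principal
    exact hx ▸ Submodule.fg_span_singleton x⟩
  obtain ⟨n, hn⟩ := monotone_stabilizes_iff_noetherian.2 this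
    ⟨fun n => Submodule.span Rᵐᵒᵖ {d n}, monotone_nat_of_le_succ fun n => by
      rw [Submodule.span_singleton_le_iff_mem, Submodule.mem_span_singleton, hda n]
      exact ⟨op (a n), rfl⟩⟩
  have hmem : d (n + 1) ∈ Submodule.span Rᵐᵒᵖ {d n} :=
    (hn (n + 1) n.le_succ).ge (Submodule.mem_span_singleton_self _)
  obtain ⟨x, hx⟩ := Submodule.mem_span_singleton.1 hmem
  exact ⟨n, x.unop, hx.symm⟩

theorem isPRIR_of_maximalRightIdealsPrincipal (hR : IsSemiprimeRing R)
    (hK : HasKrullDim Rᵐᵒᵖ R) (hacc : RegularACC Rᵐᵒᵖ) (hmax : MaximalRightIdealsPrincipal R) :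
    IsPRIR R :=
  isPLIR_op_iff.1 (isPLIR_of_maximalLeftIdealsPrincipal hR.op
    (hK.imp fun _ h => krullClass_op_iff.2 h) hacc hmax.op)

theorem rKdim_le_one_iff :
    rKdim R ≤ 1 ↔ KrullClass Rᵐᵒᵖ (1 : WithBot Ordinal.{u}) R :=
  krullDimModule_le_iff 1

theorem lKdim_le_one_iff :
    lKdim R ≤ 1 ↔ KrullClass R (1 : WithBot Ordinal.{u}) R :=
  krullDimModule_le_iff 1

theorem rKdim_le_one_of_isPRIR (hR : IsSemiprimeRing R) (hacc : LeftACCReg R) (hP : IsPRIR R) :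
    rKdim R ≤ 1 :=
  rKdim_le_one_iff.2 (krullClass_op_iff.1
    (krullClass_one_of_isPLIR hR.op hacc.op (isPLIR_op_iff.2 hP)))

end Opposite

theorem proposition7p4 {R : Type u} [Ring R] (hR : IsSemiprimeRing R) :
    (HasKrullDim Rᵐᵒᵖ R → LeftACCReg R → MaximalRightIdealsPrincipal R →
      rKdim R ≤ 1 ∧ IsPRIR R) ∧
    (IsPIR R ↔
      (lKdim R ≤ 1 ∧ rKdim R ≤ 1) ∧
        MaximalLeftIdealsPrincipal R ∧ MaximalRightIdealsPrincipal R) ∧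
    (LeftACCReg R → (IsPRIR R ↔ rKdim R ≤ 1 ∧ MaximalRightIdealsPrincipal R)) := by
  refine ⟨fun hK hacc hmax => ?_, ⟨?_, ?_⟩, fun hacc => ⟨fun hP => ?_, ?_⟩⟩
  · have hP := isPRIR_of_maximalRightIdealsPrincipal hR hK hacc.op hmax
    exact ⟨rKdim_le_one_of_isPRIR hR hacc hP, hP⟩
  · rintro ⟨hr, hl⟩
    have : IsPrincipalIdealRing R := ⟨hl⟩
    exact ⟨⟨lKdim_le_one_iff.2 (krullClass_one_of_isPLIR hR (.of_isPRIR hr) hl),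
      rKdim_le_one_of_isPRIR hR .of_isNoetherian hr⟩, fun I _ => hl I, fun I _ => hr I⟩
  · rintro ⟨⟨hl, hr⟩, hml, hmr⟩
    rw [lKdim_le_one_iff] at hl
    rw [rKdim_le_one_iff] at hr
    exact ⟨isPRIR_of_maximalRightIdealsPrincipal hR ⟨1, hr⟩
      ((krullClass_op_iff.2 hr).regularACC hR.op) hmr,
      isPLIR_of_maximalLeftIdealsPrincipal hR ⟨1, hl⟩ (hl.regularACC hR) hml⟩
  · exact ⟨rKdim_le_one_of_isPRIR hR hacc hP, fun I _ => hP I⟩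
  · rintro ⟨hr, hm⟩
    exact isPRIR_of_maximalRightIdealsPrincipal hR ⟨1, rKdim_le_one_iff.1 hr⟩ hacc.op hm
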